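/- Let $K$ be a field, let $d\ge 1$ be an integer, put $n=2d+1$ and $R=K[x_1,\dots,x_n]$. For a partition $\lambda$ of $n$ let $\operatorname{Tab}(\lambda)$ be the set of Young tableaux of shape $\lambda$ (bijective fillings of the Young diagram by $1,\dots,n$), and let $\{T\}$ denote the tabloid (row equivalence class) of $T\in\operatorname{Tab}(\lambda)$. Let $C(T)$ be the column stabilizer of $T$, let $e(T)=\sum_{\pi\in C(T)}\operatorname{sgn}(\pi)\{\pi T\}$ be the polytabloid of $T$, and let the Specht module $V_\lambda$ be the $K$-span of all $e(T)$, $T\in\operatorname{Tab}(\lambda)$, in the vector space with basis the tabloids of shape $\lambda$. Consider the graded free $R$-modules $F_0=R$ and $$F_i=V_{(d,\,d-i+1,\,1^i)}\otimes_K R(-d-i-1)\qquad(1\le i\le d).$$ For $T\in\operatorname{Tab}(d,d,1)$ let $f_T\in R$ be the Specht polynomial of $T$, that is, the product of $x_a-x_b$ over all pairs of entries $a,b$ in the same column of $T$ with $a$ above $b$. For $2\le i\le d$ and $T\in\operatorname{Tab}(d,d-i+1,1^i)$ let $a_1,\dots,a_{i+2}$ be the first column of $T$ from top to bottom and let $a_1,b_2,\dots,b_d$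 be its first row. For $1\le j\le i+2$ let $T_j\in\operatorname{Tab}(d,d-i+2,1^{i-1})$ be the tableau obtained from $T$ by deleting $a_j$ from the first column, moving the entries below it up by one cell, and putting $a_j$ at the right end of the second row. Let $H=H(T)$ be the set of permutations $\sigma$ of $\{b_{d-i+2},b_{d-i+3},\dots,b_d\}$ with $\sigma(b_{d-i+3})<\sigma(b_{d-i+4})<\dots<\sigma(b_d)$ (so $H=\{\mathrm{id}\}$ if $i=2$), and put $$\delta_i(T)=\sum_{j=1}^{i+2}\ \sum_{\sigma\in H}(-1)^{j-1}\,e(\sigma(T_j))\otimes x_{a_j}\in F_{i-1}.$$ Then the following maps are well-defined: 1. there is a unique $R$-linear map $\partial_1:F_1\to F_0$ with $\partial_1(e(T)\otimes 1)=f_T$ for all $T\in\operatorname{Tab}(d,d,1)$; 2. for every $i$ with $2\le i\le d-1$ there is a unique $R$-linear map $\partial_i:F_i\to F_{i-1}$ with $\partial_i(e(T)\otimes 1)=\delta_i(T)$ for all $T\in\operatorname{Tab}(d,d-i+1,1^i)$; 3. if $d\ge 2$, there is a unique $R$-linear map $\partial_d:F_d\to F_{d-1}$ with $\partial_d(e(T)\otimes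 1)=\delta_d(T)$ for all standard tableaux $T$ of shape $(d,1^{d+1})$. Moreover, all these maps are homogeneous of degree $0$. -/

import Mathlib

open scoped TensorProduct

namespace SpechtComplex

/-- Young tableaux of shape `μ`: bijective fillings of the cells of `μ` by `Fin n`
(the numbers `1, …, n` shifted by one). Cells are pairs (row, column), counted from `0`. -/
abbrev Tab (μ : YoungDiagram) (n : ℕ) : Type := {x : ℕ × ℕ // x ∈ μ} ≃ Fin n

/-- The tableau `σT`, obtained by applying the permutation `σ` to every entry of `T`. -/
def permTab {μ : YoungDiagram} {n : ℕ} (σ : Equiv.Perm (Fin n)) (T : Tab μ n) : Tab μ n :=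
  T.trans σ

/-- The row of `T` that contains the number `a`. -/
def rowOf {μ : YoungDiagram} {n : ℕ} (T : Tab μ n) (a : Fin n) : ℕ := (T.symm a).1.1

/-- The column of `T` that contains the number `a`. -/
def colOf {μ : YoungDiagram} {n : ℕ} (T : Tab μ n) (a : Fin n) : ℕ := (T.symm a).1.2

/-- A tableau is standard if its entries increase along rows and down columns. -/
def IsStandard {μ : YoungDiagram} {n : ℕ} (T : Tab μ n) : Prop :=
  (∀ p q : {x : ℕ × ℕ // x ∈ μ}, p.1.1 = q.1.1 → p.1.2 < q.1.2 → T p < T q) ∧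
  (∀ p q : {x : ℕ × ℕ // x ∈ μ}, p.1.2 = q.1.2 → p.1.1 < q.1.1 → T p < T q)

/-- Row equivalence: corresponding rows of the two tableaux contain the same numbers. -/
def rowSetoid (μ : YoungDiagram) (n : ℕ) : Setoid (Tab μ n) where
  r T T' := ∀ a, rowOf T a = rowOf T' a
  iseqv := ⟨fun _ _ => rfl, fun h a => (h a).symm, fun h h' a => (h a).trans (h' a)⟩

/-- Tabloids: row equivalence classes of tableaux. -/
def Tabloid (μ : YoungDiagram) (n : ℕ) : Type := Quotient (rowSetoid μ n)

/-- The tabloid `{T}` of a tableau `T`. -/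
def tabloid {μ : YoungDiagram} {n : ℕ} (T : Tab μ n) : Tabloid μ n :=
  Quotient.mk (rowSetoid μ n) T

/-- The column stabilizer `C(T)`: the permutations that map every column of `T` to itself. -/
def colStab {μ : YoungDiagram} {n : ℕ} (T : Tab μ n) : Finset (Equiv.Perm (Fin n)) :=
  {π | ∀ a, colOf T (π a) = colOf T a}

/-- The polytabloid `e(T) = ∑_{π ∈ C(T)} sgn(π) {πT}`, in the vector space with basis the
tabloids of shape `μ`. -/
noncomputable def polytabloid (K : Type*) [Field K] {μ : YoungDiagram} {n : ℕ} (T : Tab μ n) :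
    Tabloid μ n →₀ K :=
  ∑ π ∈ colStab T, Finsupp.single (tabloid (permTab π T)) ((Equiv.Perm.sign π : ℤ) : K)

/-- The Specht module `V_μ`: the span of all polytabloids of shape `μ`. -/
noncomputable def SpechtModule (K : Type*) [Field K] (μ : YoungDiagram) (n : ℕ) :
    Submodule K (Tabloid μ n →₀ K) :=
  Submodule.span K (Set.range fun T : Tab μ n => polytabloid K T)

/-- The polytabloid `e(T)` as an element of the Specht module. -/
noncomputable def e (K : Type*) [Field K] {μ : YoungDiagram} {n : ℕ} (T : Tab μ n) :
    SpechtModule K μ n :=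
  ⟨polytabloid K T, Submodule.subset_span ⟨T, rfl⟩⟩

/-- The Specht polynomial `f_T`: the product of `x_a - x_b` over all pairs `a`, `b` of entries
in the same column of `T` with `a` above `b`. -/
noncomputable def spechtPoly (K : Type*) [Field K] {μ : YoungDiagram} {n : ℕ} (T : Tab μ n) :
    MvPolynomial (Fin n) K :=
  ∏ a : Fin n, ∏ b : Fin n with colOf T a = colOf T b ∧ rowOf T a < rowOf T b,
    (MvPolynomial.X a - MvPolynomial.X b)

/-- The Young diagram of the partition `(d, d-i+1, 1^i)` of `2d+1`, for `1 ≤ i ≤ d`.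
(The definition makes sense for all `d` and `i`, but is only used in that range.) -/
def shape (d i : ℕ) : YoungDiagram where
  cells := {x ∈ Finset.range (i + 2) ×ˢ Finset.range d |
    x.1 = 0 ∨ (x.1 = 1 ∧ x.2 + i ≤ d) ∨ x.2 = 0}
  isLowerSet := by
    rintro ⟨r, c⟩ ⟨r', c'⟩ h hx
    have h1 : r' ≤ r := h.1
    have h2 : c' ≤ c := h.2
    simp only [Finset.coe_filter, Finset.mem_product, Finset.mem_range, Set.mem_ofPred_eq] at hx ⊢
    omega

theorem mem_shape {d i : ℕ} {x : ℕ × ℕ} : x ∈ shape d i ↔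
    (x.1 < i + 2 ∧ x.2 < d) ∧ (x.1 = 0 ∨ (x.1 = 1 ∧ x.2 + i ≤ d) ∨ x.2 = 0) := by
  rw [← YoungDiagram.mem_cells]
  simp [shape]

/-- Deleting the `j`-th cell of the first column of `(d, d-i+1, 1^i)` (`j = 0, …, i+1`), moving
up the cells below it, and putting it at the end of the second row gives `(d, d-i+2, 1^(i-1))`.
This is the resulting map from the cells of the new diagram to those of the old one. -/
def moveFun (d i j : ℕ) (x : ℕ × ℕ) : ℕ × ℕ :=
  if x.1 = 1 ∧ x.2 = d - i + 1 then (j, 0)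
  else if x.2 = 0 ∧ j ≤ x.1 then (x.1 + 1, 0)
  else x

/-- The inverse of `moveFun`. -/
def moveInv (d i j : ℕ) (y : ℕ × ℕ) : ℕ × ℕ :=
  if y.2 = 0 ∧ y.1 = j then (1, d - i + 1)
  else if y.2 = 0 ∧ j < y.1 then (y.1 - 1, 0)
  else y

/-- `moveFun` as a bijection of cells. -/
def moveCell {d i : ℕ} (hi : 2 ≤ i) (hid : i ≤ d) (j : Fin (i + 2)) :
    {x : ℕ × ℕ // x ∈ shape d (i - 1)} ≃ {x : ℕ × ℕ // x ∈ shape d i} where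
  toFun x := ⟨moveFun d i j x.1, by
    obtain ⟨⟨r, c⟩, hx⟩ := x
    rw [mem_shape] at hx ⊢
    have hj := j.2
    dsimp only [moveFun] at hx ⊢
    split_ifs <;> dsimp only <;> omega⟩
  invFun y := ⟨moveInv d i j y.1, by
    obtain ⟨⟨r, c⟩, hy⟩ := y
    rw [mem_shape] at hy ⊢
    have hj := j.2
    dsimp only [moveInv] at hy ⊢
    split_ifs <;> dsimp only <;> omega⟩
  left_inv x := by
    obtain ⟨⟨r, c⟩, hx⟩ := x
    rw [mem_shape] at hx
    have hj := j.2
    apply Subtype.ext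
    dsimp only [moveFun, moveInv] at hx ⊢
    split_ifs <;> apply Prod.ext <;> dsimp only at * <;> omega
  right_inv y := by
    obtain ⟨⟨r, c⟩, hy⟩ := y
    rw [mem_shape] at hy
    have hj := j.2
    apply Subtype.ext
    dsimp only [moveFun, moveInv] at hy ⊢
    split_ifs <;> apply Prod.ext <;> dsimp only at * <;> first | omega | simp_all

/-- The tableau `T_j`, with `j` counted from `0`: the entry `a_j` of the first column of `T` is
removed, the entries below it move up, and `a_j` is put at the end of the second row. -/
def moveTab {d i n : ℕ} (hi : 2 ≤ i) (hid : i ≤ d) (T : Tab (shape d i) n) (j : Fin (i + 2)) :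
    Tab (shape d (i - 1)) n :=
  (moveCell hi hid j).trans T

/-- The entry of `T` in the first column and the `j`-th row, with `j` counted from `0`. -/
def firstCol {d i n : ℕ} (hi : 2 ≤ i) (hid : i ≤ d) (T : Tab (shape d i) n) (j : Fin (i + 2)) :
    Fin n :=
  T ⟨(j, 0), by
    have hj := j.2
    rw [mem_shape]
    dsimp only
    omega⟩

/-- The set `H` of permutations `σ` of the entries `b_{d-i+2}, …, b_d` of the first row of `T`
(with columns counted from `0`, those in the columns `d-i+1, …, d-1`) such that
`σ(b_{d-i+3}) < ⋯ < σ(b_d)`. If `i = 2`, then `H` consists of the identity only. -/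
def H {d i n : ℕ} (T : Tab (shape d i) n) : Finset (Equiv.Perm (Fin n)) :=
  {σ | (∀ a, ¬ (rowOf T a = 0 ∧ d - i + 1 ≤ colOf T a) → σ a = a) ∧
    ∀ a b, rowOf T a = 0 → rowOf T b = 0 → d - i + 2 ≤ colOf T a → colOf T a < colOf T b →
      σ a < σ b}

/-- The polynomial ring `R = K[x_1, …, x_n]` with `n = 2d+1`. -/
abbrev R (K : Type*) [Field K] (d : ℕ) : Type _ := MvPolynomial (Fin (2 * d + 1)) K

/-- The `R`-module `F_i = V_{(d, d-i+1, 1^i)} ⊗_K R`, for `1 ≤ i ≤ d`, with the tensor factors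
in the order in which Mathlib has the extension of scalars from `K` to `R`. -/
abbrev F (K : Type*) [Field K] (d i : ℕ) : Type _ :=
  R K d ⊗[K] SpechtModule K (shape d i) (2 * d + 1)

/-- The generator `e(T) ⊗ 1` of `F_i`. -/
noncomputable def gen (K : Type*) [Field K] {d i : ℕ} (T : Tab (shape d i) (2 * d + 1)) :
    F K d i :=
  1 ⊗ₜ[K] e K T

/-- The part of degree `m` of `F_i = V_{(d, d-i+1, 1^i)} ⊗_K R(-d-i-1)`. -/
noncomputable def degreePart (K : Type*) [Field K] (d i m : ℕ) : Submodule K (F K d i) :=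
  Submodule.span K {z | ∃ (k : ℕ) (p : R K d) (v : SpechtModule K (shape d i) (2 * d + 1)),
    p.IsHomogeneous k ∧ k + (d + i + 1) = m ∧ z = p ⊗ₜ[K] v}

/-- The element `∑_j ∑_{σ ∈ H} (-1)^{j-1} e(σ(T_j)) ⊗ x_{a_j}` of `F_{i-1}`
(the sign is `(-1)^j` because here `j` is counted from `0`). -/
noncomputable def diffValue (K : Type*) [Field K] {d i : ℕ} (hi : 2 ≤ i) (hid : i ≤ d)
    (T : Tab (shape d i) (2 * d + 1)) : F K d (i - 1) :=
  ∑ j : Fin (i + 2), ∑ σ ∈ H T,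
    ((-1 : K) ^ (j : ℕ)) •
      ((MvPolynomial.X (firstCol hi hid T j) : R K d) ⊗ₜ[K] e K (permTab σ (moveTab hi hid T j)))

end SpechtComplex

/-! Well-definedness means that every linear relation among polytabloids also holds among the
prescribed values. No relations are used for this: each map is restricted from a linear map defined
on all tabloids, where the tabloids form a basis and values can be chosen freely.

The tool is `tabloidEval`: given ring elements `y a r`, a tabloid goes to the product of `y a r`
over all `a`, with `r` the row of `a`. A polytabloid then becomes a product of determinants, one per
column (`tabloidEval_polytabloid_eq_prod`). With independent variables for `y` this is injective
(`tabloidEval_X_injective`), so `F_i` embeds in a polynomial ring over `R`, and identities in `F_i`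
become identities of determinants. With `y a r = x_a ^ r` the determinants are Vandermonde, which
gives the first map up to the sign `(-1)^d`.

For `i ≥ 2`, put `x_a * y a ε` in place of the last row and expand the determinant of the first
column along it: this gives the alternating sum over `j`. Each `e(σ(T_j))` contributes a 2×2
determinant with entries `σ(b)` and `a_j`, where `b` is the first entry of the tail (the row entries
in columns of length one). Its two terms, summed over `H`, give `i - 1` times the product of all `y
b 0`, and the sum of products with one `y b 0` changed to `y b 1`. The latter is the linear
coefficient in `t` after row 1 is added `t` times to row 0, which leaves all longer columns
unchanged. Hence the difference of two evaluations, `diffEval`, is the required map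
(`diffEval_polytabloid`, `exists_linearMap_of_embed`).

Uniqueness holds because polytabloids span; for the hook, standard ones suffice
(`span_standard_hook`), by sorting and Cramer's rule. -/

namespace SpechtComplex

/-! ### Entries of tableaux -/

section Entries

variable {μ : YoungDiagram} {n : ℕ}

theorem rowOf_colOf_mem (T : Tab μ n) (a : Fin n) : (rowOf T a, colOf T a) ∈ μ :=
  (T.symm a).2

variable [NeZero n]

/-- The entry of `T` in row `r` and column `c` (junk value `0` outside of the diagram). -/
def entry (T : Tab μ n) (r c : ℕ) : Fin n :=
  if h : (r, c) ∈ μ then T ⟨(r, c), h⟩ else 0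

theorem entry_of_mem (T : Tab μ n) {r c : ℕ} (h : (r, c) ∈ μ) :
    entry T r c = T ⟨(r, c), h⟩ := dif_pos h

theorem rowOf_entry (T : Tab μ n) {r c : ℕ} (h : (r, c) ∈ μ) : rowOf T (entry T r c) = r := by
  simp [entry_of_mem T h, rowOf]

theorem colOf_entry (T : Tab μ n) {r c : ℕ} (h : (r, c) ∈ μ) : colOf T (entry T r c) = c := by
  simp [entry_of_mem T h, colOf]

theorem entry_rowOf_colOf (T : Tab μ n) (a : Fin n) : entry T (rowOf T a) (colOf T a) = a := by
  rw [entry_of_mem T (rowOf_colOf_mem T a)]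
  exact T.apply_symm_apply a

theorem entry_permTab (σ : Equiv.Perm (Fin n)) (T : Tab μ n) {r c : ℕ} (h : (r, c) ∈ μ) :
    entry (permTab σ T) r c = σ (entry T r c) := by
  rw [entry_of_mem _ h, entry_of_mem _ h]; rfl

theorem entry_inj (T : Tab μ n) {r c r' c' : ℕ} (h : (r, c) ∈ μ) (h' : (r', c') ∈ μ)
    (he : entry T r c = entry T r' c') : r = r' ∧ c = c' := by
  constructor
  · rw [← rowOf_entry T h, he, rowOf_entry T h']
  · rw [← colOf_entry T h, he, colOf_entry T h']

end Entries

/-! ### Evaluation of tabloids in a commutative ring -/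

section Eval

variable {μ : YoungDiagram} {n : ℕ}

/-- The row of a tabloid that contains the number `a`. -/
def tabloidRow (t : Tabloid μ n) : Fin n → ℕ :=
  Quotient.lift (s := rowSetoid μ n) rowOf (fun _ _ h => funext h) t

theorem tabloidRow_injective : Function.Injective (tabloidRow (μ := μ) (n := n)) := by
  intro s t
  induction s using Quotient.inductionOn
  induction t using Quotient.inductionOn
  intro h
  exact Quotient.sound fun a => congrFun h a

/-- The block of a column in the matrix of `tabloidEval_polytabloid`. -/
theorem det_column_block {A : Type*} [CommRing A] [NeZero n] (y : Fin n → ℕ → A)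
    (T : Tab μ n) (c m : ℕ)
    (hc : ∀ r, (r, c) ∈ μ ↔ r < m) :
    ((Matrix.of fun b a => if colOf T b = colOf T a then y b (rowOf T a) else 0).toSquareBlock
      (colOf T) c).det = (Matrix.of fun r s : Fin m => y (entry T r c) s).det := by
  let f : Fin m ≃ {a // colOf T a = c} :=
    { toFun := fun r => ⟨entry T r c, colOf_entry T ((hc r).2 r.2)⟩
      invFun := fun a => ⟨rowOf T a, (hc _).1 (by
        have := rowOf_colOf_mem T a.1
        rwa [a.2] at this)⟩
      left_inv := fun r => Fin.ext (rowOf_entry T ((hc r).2 r.2))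
      right_inv := fun a => Subtype.ext (by
        have := entry_rowOf_colOf T a.1
        rwa [a.2] at this) }
  rw [← Matrix.det_submatrix_equiv_self f]
  congr 1
  ext r s
  simp [Matrix.toSquareBlock_def, f, colOf_entry T ((hc r).2 r.2), colOf_entry T ((hc s).2 s.2),
    rowOf_entry T ((hc s).2 s.2)]

variable (K : Type*) [Field K] {A : Type*} [CommRing A] [Algebra K A]

/-- The linear map that sends the tabloid `{T}` to the product of all `y a r`, where `r` is the
row of `T` that contains `a`. -/
noncomputable def tabloidEval (μ : YoungDiagram) {n : ℕ} (y : Fin n → ℕ → A) :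
    (Tabloid μ n →₀ K) →ₗ[K] A :=
  Finsupp.linearCombination K fun t => ∏ a, y a (tabloidRow t a)

/-- This is the Leibniz expansion: a permutation outside the column stabilizer meets a zero entry of
the matrix. -/
theorem tabloidEval_polytabloid (y : Fin n → ℕ → A) (T : Tab μ n) :
    tabloidEval K μ y (polytabloid K T) =
      (Matrix.of fun b a => if colOf T b = colOf T a then y b (rowOf T a) else 0).det := by
  classical
  rw [Matrix.det_apply', polytabloid, map_sum, colStab, Finset.sum_filter]
  refine Finset.sum_congr rfl fun π _ => ?_
  split_ifs with h
  · simp only [tabloidEval, Finsupp.linearCombination_single, Matrix.of_apply, h, if_true]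
    rw [Algebra.smul_def, map_intCast]
    congr 1
    rw [← Equiv.prod_comp π]
    refine Finset.prod_congr rfl fun a _ => ?_
    congr 1
    change rowOf (permTab π T) (π a) = _
    simp [rowOf, permTab]
  · push Not at h
    obtain ⟨a, ha⟩ := h
    rw [Finset.prod_eq_zero (Finset.mem_univ a) (by simp [ha]), mul_zero]

/-- Entries from different columns of `T` give zeros, so the matrix is block diagonal with one block
per column. -/
theorem tabloidEval_polytabloid_eq_prod [NeZero n] (y : Fin n → ℕ → A) (T : Tab μ n) (d : ℕ)
    (len : ℕ → ℕ) (hlen : ∀ r c, c < d → ((r, c) ∈ μ ↔ r < len c)) (hpos : ∀ c < d, 0 < len c)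
    (hd : ∀ r c, (r, c) ∈ μ → c < d) :
    tabloidEval K μ y (polytabloid K T) =
      ∏ c ∈ Finset.range d, (Matrix.of fun r s : Fin (len c) => y (entry T r c) s).det := by
  classical
  rw [tabloidEval_polytabloid, Matrix.BlockTriangular.det (b := colOf T)]
  · have him : Finset.univ.image (colOf T) = Finset.range d := by
      ext c
      simp only [Finset.mem_image, Finset.mem_univ, true_and, Finset.mem_range]
      constructor
      · rintro ⟨a, rfl⟩
        exact hd _ _ (rowOf_colOf_mem T a)
      · exact fun h => ⟨entry T 0 c, colOf_entry T ((hlen 0 c h).2 (hpos c h))⟩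
    rw [him]
    exact Finset.prod_congr rfl fun c hc =>
      det_column_block y T c (len c) fun r => hlen r c (Finset.mem_range.1 hc)
  · intro a b hab
    simp [hab.ne']

/-- The entries of the rows of tableaux as variables: the corresponding evaluation separates
tabloids. -/
theorem tabloidEval_X_injective :
    Function.Injective (tabloidEval K μ
      fun (a : Fin n) (r : ℕ) => (MvPolynomial.X (a, r) : MvPolynomial (Fin n × ℕ) K)) := by
  classical
  have key : LinearIndependent K fun t : Tabloid μ n =>
      ∏ a, (MvPolynomial.X (a, tabloidRow t a) : MvPolynomial (Fin n × ℕ) K) := by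
    have hmon : (fun t : Tabloid μ n =>
        ∏ a, (MvPolynomial.X (a, tabloidRow t a) : MvPolynomial (Fin n × ℕ) K)) =
        MvPolynomial.basisMonomials (Fin n × ℕ) K ∘
          fun t => ∑ a, Finsupp.single (a, tabloidRow t a) 1 := by
      funext t
      simp [MvPolynomial.X, MvPolynomial.monomial_sum_one]
    rw [hmon]
    -- Distinct tabloids have distinct monomials: the exponent at `(a, r)` is 1 exactly when `a`
    -- lies in row `r`.
    refine (MvPolynomial.basisMonomials (Fin n × ℕ) K).linearIndependent.comp _ ?_
    intro s t hst
    refine tabloidRow_injective (funext fun a => ?_)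
    have h := DFunLike.congr_fun hst (a, tabloidRow s a)
    simp only [Finsupp.finsetSum_apply, Finsupp.single_apply, Prod.mk.injEq] at h
    rw [Finset.sum_eq_single a, Finset.sum_eq_single a] at h
    · by_contra hne
      simp [Ne.symm hne] at h
    · exact fun b _ hb => if_neg fun hba => hb hba.1
    · simp
    · exact fun b _ hb => if_neg fun hba => hb hba.1
    · simp
  exact key

end Eval

/-! ### Sums over increasing rearrangements -/

section Rearrange

variable {n m : ℕ}

/-- The permutations of the values of `b` that leave the values of `b` at `1, …, m` increasing
and fix everything else. -/
def tailPerms (b : Fin (m + 1) → Fin n) : Finset (Equiv.Perm (Fin n)) :=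
  {σ | (∀ a, (∀ j, b j ≠ a) → σ a = a) ∧ StrictMono fun j : Fin m => σ (b j.succ)}

theorem mem_tailPerms {b : Fin (m + 1) → Fin n} {σ : Equiv.Perm (Fin n)} :
    σ ∈ tailPerms b ↔
      (∀ a, (∀ j, b j ≠ a) → σ a = a) ∧ StrictMono fun j : Fin m => σ (b j.succ) := by
  simp [tailPerms]

theorem exists_of_mem_tailPerms {b : Fin (m + 1) → Fin n} {σ : Equiv.Perm (Fin n)}
    (hσ : σ ∈ tailPerms b) (j : Fin (m + 1)) : ∃ k, b k = σ (b j) := by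
  by_contra! h
  have h1 := (mem_tailPerms.1 hσ).1 _ h
  exact h j (σ.injective h1).symm

theorem image_tail_of_mem_tailPerms {b : Fin (m + 1) → Fin n} (hb : Function.Injective b)
    {σ : Equiv.Perm (Fin n)} (hσ : σ ∈ tailPerms b) :
    Finset.univ.image (fun j : Fin m => σ (b j.succ)) =
      (Finset.univ.image b).erase (σ (b 0)) := by
  refine Finset.eq_of_subset_of_card_le ?_ ?_
  · intro x hx
    obtain ⟨j, -, rfl⟩ := Finset.mem_image.1 hx
    obtain ⟨k, hk⟩ := exists_of_mem_tailPerms hσ j.succ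
    refine Finset.mem_erase.2 ⟨fun h => ?_, Finset.mem_image.2 ⟨k, Finset.mem_univ _, hk⟩⟩
    exact Fin.succ_ne_zero j (hb (σ.injective h))
  · obtain ⟨k, hk⟩ := exists_of_mem_tailPerms hσ 0
    rw [Finset.card_erase_of_mem (Finset.mem_image.2 ⟨k, Finset.mem_univ _, hk⟩),
      Finset.card_image_of_injective _ hb, Finset.card_image_of_injective]
    · simp
    · exact σ.injective.comp (hb.comp (Fin.succ_injective m))

theorem exists_mem_tailPerms {b : Fin (m + 1) → Fin n} (hb : Function.Injective b)
    (j : Fin (m + 1)) : ∃ σ ∈ tailPerms b, σ (b 0) = b j := by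
  classical
  let h : Fin m → Fin n := fun k => b (j.succAbove k)
  have hh : Function.Injective h := hb.comp Fin.succAbove_right_injective
  -- Sends `0` to `j` and lists the remaining indices so that the values of `b` increase.
  let ρ : Equiv.Perm (Fin (m + 1)) :=
    (Equiv.Perm.decomposeFin.symm (0, Tuple.sort h)).trans j.cycleRange.symm
  have hρ0 : ρ 0 = j := by simp [ρ]
  have hρs : ∀ k : Fin m, ρ k.succ = j.succAbove (Tuple.sort h k) := by
    intro k
    simp [ρ]
  refine ⟨ρ.viaFintypeEmbedding ⟨b, hb⟩, mem_tailPerms.2 ⟨fun a ha => ?_, ?_⟩, ?_⟩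
  · refine Equiv.Perm.viaFintypeEmbedding_apply_notMem_range _ _ ?_
    rintro ⟨k, hk⟩
    exact ha k hk
  · have : (fun k : Fin m => ρ.viaFintypeEmbedding ⟨b, hb⟩ (b k.succ)) = h ∘ Tuple.sort h := by
      funext k
      have := Equiv.Perm.viaFintypeEmbedding_apply_image ρ ⟨b, hb⟩ k.succ
      rw [Function.Embedding.coeFn_mk] at this
      rw [this, hρs]
      rfl
    rw [this]
    exact (Tuple.monotone_sort h).strictMono_of_injective (hh.comp (Tuple.sort h).injective)
  · have := Equiv.Perm.viaFintypeEmbedding_apply_image ρ ⟨b, hb⟩ 0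
    rw [Function.Embedding.coeFn_mk] at this
    rw [this, hρ0]

/-- The map `σ ↦ σ (b 0)` is a bijection onto the values of `b`, because an increasing sequence is
determined by its set of values. -/
theorem sum_tailPerms {A : Type*} [CommRing A] {b : Fin (m + 1) → Fin n}
    (hb : Function.Injective b) (f g : Fin n → A) :
    ∑ σ ∈ tailPerms b, f (σ (b 0)) * ∏ j : Fin m, g (σ (b j.succ)) =
      ∑ x ∈ Finset.univ.image b, f x * ∏ x' ∈ (Finset.univ.image b).erase x, g x' := by
  refine Finset.sum_bij (fun σ _ => σ (b 0)) ?_ ?_ ?_ ?_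
  · intro σ hσ
    obtain ⟨k, hk⟩ := exists_of_mem_tailPerms hσ 0
    exact Finset.mem_image.2 ⟨k, Finset.mem_univ _, hk⟩
  · intro σ hσ τ hτ hστ
    have him := image_tail_of_mem_tailPerms hb hσ
    rw [show σ (b 0) = τ (b 0) from hστ, ← image_tail_of_mem_tailPerms hb hτ] at him
    have hr := congrArg (fun s : Finset (Fin n) => (s : Set (Fin n))) him
    simp only [Finset.coe_image, Finset.coe_univ, Set.image_univ] at hr
    have hs := ((mem_tailPerms.1 hσ).2.range_inj (mem_tailPerms.1 hτ).2).1 hr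
    ext1 a
    by_cases ha : ∃ j, b j = a
    · obtain ⟨j, rfl⟩ := ha
      induction j using Fin.cases with
      | zero => exact hστ
      | succ j => exact congrFun hs j
    · push Not at ha
      rw [(mem_tailPerms.1 hσ).1 a ha, (mem_tailPerms.1 hτ).1 a ha]
  · intro x hx
    obtain ⟨j, -, rfl⟩ := Finset.mem_image.1 hx
    obtain ⟨σ, hσ, h⟩ := exists_mem_tailPerms hb j
    exact ⟨σ, hσ, h⟩
  · intro σ hσ
    rw [← image_tail_of_mem_tailPerms hb hσ, Finset.prod_image]
    exact fun x _ y _ h => Fin.succ_injective m (hb (σ.injective h))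

theorem coeff_one_prod_C_add_X_mul_C {A ι : Type*} [CommRing A] [DecidableEq ι] (s : Finset ι)
    (f g : ι → A) :
    (∏ x ∈ s, (Polynomial.C (g x) + Polynomial.X * Polynomial.C (f x))).coeff 1 =
      ∑ x ∈ s, f x * ∏ x' ∈ s.erase x, g x' := by
  -- The linear coefficient is the derivative at `0`, so the Leibniz rule for products gives the
  -- sum.
  have h : ∀ p : Polynomial A, p.coeff 1 = p.derivative.eval 0 := by
    intro p
    simp [← Polynomial.coeff_zero_eq_eval_zero, Polynomial.coeff_derivative]
  rw [h, Polynomial.derivative_prod_finset, Polynomial.eval_finsetSum]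
  refine Finset.sum_congr rfl fun x _ => ?_
  rw [mul_comm]
  simp [Polynomial.eval_prod]

end Rearrange

/-- A column operation; the size `m + 2` guarantees that column 1 exists. -/
theorem det_of_add_mul_column {A : Type*} [CommRing A] {n m : ℕ} (y y' : Fin n → ℕ → A)
    (t : A) (a : Fin (m + 2) → Fin n)
    (h0 : ∀ b, y' b 0 = y b 0 + t * y b 1) (h : ∀ b r, 1 ≤ r → y' b r = y b r) :
    (Matrix.of fun r s : Fin (m + 2) => y' (a r) s).det =
      (Matrix.of fun r s : Fin (m + 2) => y (a r) s).det := by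
  rw [← Matrix.det_updateCol_add_smul_self (Matrix.of fun r s : Fin (m + 2) => y (a r) s)
    (show (0 : Fin (m + 2)) ≠ 1 by simp) t]
  congr 1
  ext r s
  rw [Matrix.updateCol_apply]
  split_ifs with hs
  · subst hs; simp [h0]
  · have : 1 ≤ (s : ℕ) := Nat.one_le_iff_ne_zero.2 fun h => hs (Fin.ext h)
    simp [h _ _ this]

/-! ### The shapes `(d, d-i+1, 1^i)` -/

section Shape

variable (K : Type*) [Field K] {A : Type*} [CommRing A] [Algebra K A]
variable {n : ℕ} [NeZero n] {d i : ℕ}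

theorem tabloidEval_polytabloid_shape (hi : 1 ≤ i) (hid : i ≤ d) (y : Fin n → ℕ → A)
    (T : Tab (shape d i) n) :
    tabloidEval K (shape d i) y (polytabloid K T) =
      (Matrix.of fun r s : Fin (i + 2) => y (entry T r 0) s).det *
      (∏ c ∈ Finset.Ico 1 (d - i + 1),
        (y (entry T 0 c) 0 * y (entry T 1 c) 1 - y (entry T 0 c) 1 * y (entry T 1 c) 0)) *
      ∏ c ∈ Finset.Ico (d - i + 1) d, y (entry T 0 c) 0 := by
  -- One column of length `i + 2`, then `d - i` of length 2 and `i - 1` of length 1.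
  rw [tabloidEval_polytabloid_eq_prod K y T d
    (fun c => if c = 0 then i + 2 else if c < d - i + 1 then 2 else 1)]
  · rw [Finset.range_eq_Ico, ← Finset.prod_Ico_consecutive _ (show 0 ≤ d - i + 1 by omega)
      (show d - i + 1 ≤ d by omega), Finset.prod_eq_prod_Ico_succ_bot (by omega : 0 < d - i + 1)]
    refine congrArg₂ _ (congrArg₂ _ ?_ ?_) ?_
    · rfl
    · refine Finset.prod_congr rfl fun c hc => ?_
      rw [Finset.mem_Ico] at hc
      have hlen : (if c = 0 then i + 2 else if c < d - i + 1 then 2 else 1) = 2 := by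
        rw [if_neg (by omega), if_pos (by omega)]
      rw [hlen, Matrix.det_fin_two]
      simp
    · refine Finset.prod_congr rfl fun c hc => ?_
      rw [Finset.mem_Ico] at hc
      have hlen : (if c = 0 then i + 2 else if c < d - i + 1 then 2 else 1) = 1 := by
        rw [if_neg (by omega), if_neg (by omega)]
      rw [hlen, Matrix.det_fin_one]
      simp
  · intro r c hc
    rw [mem_shape]
    dsimp only
    split_ifs <;> omega
  · intro c hc
    split_ifs <;> omega
  · intro r c h
    rw [mem_shape] at h
    exact h.1.2

end Shape

/-! ### Replacing the last row -/

/-- The last row is replaced by `x` times row `ε`. -/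
def replaceLast {A : Type*} [CommRing A] {n : ℕ} (i : ℕ) (x : Fin n → A)
    (y : Fin n → ℕ → A) (ε : ℕ) (a : Fin n) (r : ℕ) : A :=
  if r = i + 1 then x a * y a ε else y a r

/-- Laplace expansion along the last matrix column; the factor `(-1) ^ (i + 1)` cancels the sign of
that column. -/
theorem det_replaceLast {A : Type*} [CommRing A] {n : ℕ} (i : ℕ) (x : Fin n → A)
    (y : Fin n → ℕ → A) (ε : ℕ)
    (a : Fin (i + 2) → Fin n) :
    (-1) ^ (i + 1) * (Matrix.of fun r s : Fin (i + 2) => replaceLast i x y ε (a r) s).det =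
      ∑ j : Fin (i + 2), (-1) ^ (j : ℕ) * (x (a j) * y (a j) ε) *
        (Matrix.of fun r s : Fin (i + 1) => y (a (j.succAbove r)) s).det := by
  rw [Matrix.det_succ_column _ (Fin.last (i + 1)), Finset.mul_sum]
  refine Finset.sum_congr rfl fun j _ => ?_
  have hsub : (Matrix.of fun r s : Fin (i + 2) => replaceLast i x y ε (a r) s).submatrix
      j.succAbove (Fin.last (i + 1)).succAbove =
      Matrix.of fun r s : Fin (i + 1) => y (a (j.succAbove r)) s := by
    ext r s
    have hs : (s : ℕ) ≠ i + 1 := s.2.ne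
    simp [replaceLast, hs]
  rw [hsub]
  have hsign : ((-1) ^ (i + 1) * (-1) ^ (i + 1) : A) = 1 := by
    rw [← mul_pow]; simp
  simp only [Matrix.of_apply, Fin.val_last, replaceLast, if_true, pow_add] at hsign ⊢
  linear_combination (-1) ^ (j : ℕ) * (x (a j) * y (a j) ε) *
        (Matrix.of fun r s : Fin (i + 1) => y (a (j.succAbove r)) s).det * hsign

/-! ### The summands of the differential -/

section Move

variable {n : ℕ} [NeZero n] {d i : ℕ}

theorem entry_moveTab (hi : 2 ≤ i) (hid : i ≤ d) (T : Tab (shape d i) n) (j : Fin (i + 2))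
    {r c : ℕ} (h : (r, c) ∈ shape d (i - 1)) :
    entry (moveTab hi hid T j) r c =
      entry T (moveFun d i j (r, c)).1 (moveFun d i j (r, c)).2 := by
  rw [entry_of_mem _ h]
  exact (entry_of_mem T (moveCell hi hid j ⟨(r, c), h⟩).2).symm

theorem firstCol_eq_entry (hi : 2 ≤ i) (hid : i ≤ d) (T : Tab (shape d i) n) (j : Fin (i + 2)) :
    firstCol hi hid T j = entry T j 0 := by
  have hj := j.2
  rw [entry_of_mem T (mem_shape.2 (by dsimp only; omega))]
  rfl

/-- The entries of the first row of `T` that lie in columns of length one. -/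
def tailEntry {m : ℕ} (T : Tab (shape d (m + 2)) n) (k : Fin (m + 1)) : Fin n :=
  entry T 0 (d - (m + 2) + 1 + k)

theorem tailEntry_injective {m : ℕ} (hid : m + 2 ≤ d) (T : Tab (shape d (m + 2)) n) :
    Function.Injective (tailEntry T) := by
  intro k l h
  have hk := k.2
  have hl := l.2
  have := (entry_inj T (mem_shape.2 (by dsimp only; omega)) (mem_shape.2 (by dsimp only; omega))
    h).2
  exact Fin.ext (by omega)

theorem H_eq_tailPerms {m : ℕ} (hid : m + 2 ≤ d) (T : Tab (shape d (m + 2)) n) :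
    H T = tailPerms (tailEntry T) := by
  have hmem : ∀ k : Fin (m + 1), (0, d - (m + 2) + 1 + k) ∈ shape d (m + 2) := fun k => by
    have hk := k.2
    rw [mem_shape]
    dsimp only
    omega
  have hrow : ∀ k, rowOf T (tailEntry T k) = 0 := fun k => rowOf_entry T (hmem k)
  have hcol : ∀ k, colOf T (tailEntry T k) = d - (m + 2) + 1 + k := fun k => colOf_entry T (hmem k)
  have hex : ∀ a, rowOf T a = 0 → d - (m + 2) + 1 ≤ colOf T a →
      ∃ k : Fin (m + 1), (k : ℕ) = colOf T a - (d - (m + 2) + 1) ∧ tailEntry T k = a := by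
    intro a h0 hc
    have := mem_shape.1 (rowOf_colOf_mem T a)
    dsimp only at this
    refine ⟨⟨colOf T a - (d - (m + 2) + 1), by omega⟩, rfl, ?_⟩
    have he := entry_rowOf_colOf T a
    rw [h0] at he
    refine Eq.trans ?_ he
    rw [tailEntry]
    dsimp only
    congr 1
    omega
  ext σ
  rw [mem_tailPerms]
  simp only [H, Finset.mem_filter, Finset.mem_univ, true_and]
  refine and_congr ⟨fun h a ha => h a ?_, fun h a ha => h a ?_⟩ ⟨fun h k l hkl => ?_, ?_⟩
  · rintro ⟨h0, hc⟩
    obtain ⟨k, -, hk⟩ := hex a h0 hc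
    exact ha k hk
  · rintro k rfl
    exact ha ⟨hrow k, by rw [hcol]; omega⟩
  · have hkl' : (k : ℕ) < l := hkl
    refine h _ _ (hrow _) (hrow _) ?_ ?_
    · rw [hcol, Fin.val_succ]; omega
    · rw [hcol, hcol, Fin.val_succ, Fin.val_succ]; omega
  · intro h a b ha hb hac hab
    obtain ⟨k, hk, rfl⟩ := hex a ha (by omega)
    obtain ⟨l, hl, rfl⟩ := hex b hb (by omega)
    obtain ⟨k', rfl⟩ := Fin.exists_succ_eq_of_ne_zero (x := k) (by
      rintro rfl
      rw [Fin.val_zero] at hk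
      omega)
    obtain ⟨l', rfl⟩ := Fin.exists_succ_eq_of_ne_zero (x := l) (by
      rintro rfl
      rw [Fin.val_zero] at hl
      omega)
    refine h (show k' < l' from ?_)
    rw [Fin.val_succ] at hk hl
    rw [Fin.lt_def]
    omega

theorem H_apply_entry {σ : Equiv.Perm (Fin n)} {T : Tab (shape d i) n} (hσ : σ ∈ H T) {r c : ℕ}
    (hrc : (r, c) ∈ shape d i) (h : ¬ (r = 0 ∧ d - i + 1 ≤ c)) :
    σ (entry T r c) = entry T r c := by
  simp only [H, Finset.mem_filter, Finset.mem_univ, true_and] at hσ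
  refine hσ.1 _ ?_
  rwa [rowOf_entry T hrc, colOf_entry T hrc]

theorem prod_tail_eq {A : Type*} [CommRing A] {m : ℕ} (hid : m + 2 ≤ d)
    (T : Tab (shape d (m + 2)) n) (g : Fin n → A) :
    ∏ c ∈ Finset.Ico (d - (m + 2) + 1) d, g (entry T 0 c) =
      ∏ x ∈ Finset.univ.image (tailEntry T), g x := by
  rw [Finset.prod_image fun x _ y _ h => tailEntry_injective hid T h,
    Finset.prod_Ico_eq_prod_range, show d - (d - (m + 2) + 1) = m + 1 by omega,
    Finset.prod_range]
  rfl

theorem prod_tail_succ_eq {A : Type*} [CommRing A] {m : ℕ} (hid : m + 2 ≤ d)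
    (T : Tab (shape d (m + 2)) n) (g : Fin n → A) :
    ∏ c ∈ Finset.Ico (d - (m + 2) + 2) d, g (entry T 0 c) =
      ∏ k : Fin m, g (tailEntry T k.succ) := by
  rw [Finset.prod_Ico_eq_prod_range, show d - (d - (m + 2) + 2) = m by omega,
    Finset.prod_range]
  refine Finset.prod_congr rfl fun k _ => ?_
  rw [tailEntry, Fin.val_succ]
  congr 2
  omega

variable (K : Type*) [Field K] {A : Type*} [CommRing A] [Algebra K A]

/-- Moving `a_j` leaves a minor for the first column and makes a new column of length 2, with `σ` of
the first tail entry above `a_j`. All other columns of length 2 are fixed by `σ`. -/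
theorem tabloidEval_moveTab {m : ℕ} (hi : 2 ≤ m + 2) (hid : m + 2 ≤ d) (y : Fin n → ℕ → A)
    (T : Tab (shape d (m + 2)) n) (j : Fin (m + 2 + 2)) {σ : Equiv.Perm (Fin n)} (hσ : σ ∈ H T) :
    tabloidEval K (shape d (m + 2 - 1)) y (polytabloid K (permTab σ (moveTab hi hid T j))) =
      (Matrix.of fun r s : Fin (m + 3) => y (entry T (j.succAbove r) 0) s).det *
      (∏ c ∈ Finset.Ico 1 (d - (m + 2) + 1),
        (y (entry T 0 c) 0 * y (entry T 1 c) 1 - y (entry T 0 c) 1 * y (entry T 1 c) 0)) *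
      (y (σ (tailEntry T 0)) 0 * y (entry T j 0) 1 - y (σ (tailEntry T 0)) 1 * y (entry T j 0) 0) *
      ∏ k : Fin m, y (σ (tailEntry T k.succ)) 0 := by
  have hj := j.2
  have key : ∀ {r c : ℕ}, (r, c) ∈ shape d (m + 2 - 1) →
      entry (permTab σ (moveTab hi hid T j)) r c =
        σ (entry T (moveFun d (m + 2) j (r, c)).1 (moveFun d (m + 2) j (r, c)).2) := by
    intro r c h
    rw [entry_permTab _ _ h, entry_moveTab _ _ _ _ h]
  rw [tabloidEval_polytabloid_shape K (by omega) (by omega),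
    show d - (m + 2 - 1) + 1 = d - (m + 2) + 1 + 1 by omega,
    Finset.prod_Ico_succ_top (by omega), ← mul_assoc]
  refine congrArg₂ _ (congrArg₂ _ (congrArg₂ _ ?_ ?_) ?_) ?_
  · change (Matrix.of fun r s : Fin (m + 3) =>
      y (entry (permTab σ (moveTab hi hid T j)) r 0) s).det = _
    congr 1
    ext r s
    have hr := r.2
    rw [Matrix.of_apply, Matrix.of_apply, key (mem_shape.2 (by dsimp only; omega))]
    have hf : moveFun d (m + 2) j ((r : ℕ), 0) = ((j.succAbove r : ℕ), 0) := by
      rw [moveFun, if_neg (by dsimp only; omega), Fin.succAbove]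
      simp only [Fin.lt_def, Fin.val_castSucc, true_and]
      split_ifs <;> first | omega | rfl
    rw [hf]
    dsimp only
    rw [H_apply_entry hσ (mem_shape.2 (by dsimp only; omega)) (by omega)]
  · refine Finset.prod_congr rfl fun c hc => ?_
    rw [Finset.mem_Ico] at hc
    have h0 : moveFun d (m + 2) j (0, c) = (0, c) := by
      rw [moveFun, if_neg (by dsimp only; omega), if_neg (by dsimp only; omega)]
    have h1 : moveFun d (m + 2) j (1, c) = (1, c) := by
      rw [moveFun, if_neg (by dsimp only; omega), if_neg (by dsimp only; omega)]
    rw [key (mem_shape.2 (by dsimp only; omega)), key (mem_shape.2 (by dsimp only; omega)), h0, h1]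
    dsimp only
    rw [H_apply_entry hσ (mem_shape.2 (by dsimp only; omega)) (by omega),
      H_apply_entry hσ (mem_shape.2 (by dsimp only; omega)) (by omega)]
  · have h0 : moveFun d (m + 2) j (0, d - (m + 2) + 1) = (0, d - (m + 2) + 1) := by
      rw [moveFun, if_neg (by dsimp only; omega), if_neg (by dsimp only; omega)]
    have h1 : moveFun d (m + 2) j (1, d - (m + 2) + 1) = ((j : ℕ), 0) := by
      rw [moveFun, if_pos ⟨rfl, rfl⟩]
    rw [key (mem_shape.2 (by dsimp only; omega)), key (mem_shape.2 (by dsimp only; omega)), h0, h1]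
    dsimp only
    rw [H_apply_entry hσ (r := j) (c := 0) (mem_shape.2 (by dsimp only; omega)) (by omega)]
    rfl
  · rw [← prod_tail_succ_eq hid T fun a => y (σ a) 0]
    refine Finset.prod_congr rfl fun c hc => ?_
    rw [Finset.mem_Ico] at hc
    have h0 : moveFun d (m + 2) j (0, c) = (0, c) := by
      rw [moveFun, if_neg (by dsimp only; omega), if_neg (by dsimp only; omega)]
    rw [key (mem_shape.2 (by dsimp only; omega)), h0]

/-! ### The differential on tabloids -/

/-- The last row is replaced by `x` times the first row, and the second row is added to the first
one with a formal parameter as coefficient. -/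
noncomputable def replaceLastAdd (i : ℕ) (x : Fin n → A) (y : Fin n → ℕ → A) (a : Fin n) (r : ℕ) :
    Polynomial A :=
  if r = 0 then Polynomial.C (y a 0) + Polynomial.X * Polynomial.C (y a 1)
  else Polynomial.C (replaceLast i x y 0 a r)

/-- A linear map on tabloids of shape `(d, d-i+1, 1^i)` that restricts to the differential on
polytabloids. -/
noncomputable def diffEval (d i : ℕ) (x : Fin n → A) (y : Fin n → ℕ → A) :
    (Tabloid (shape d i) n →₀ K) →ₗ[K] A :=
  (-1 : K) ^ (i + 1) •
    (((i - 1 : ℕ) : K) • tabloidEval K (shape d i) (replaceLast i x y 1) -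
      (Polynomial.lcoeff A 1).restrictScalars K ∘ₗ
        tabloidEval K (shape d i) (replaceLastAdd i x y))

theorem tabloidEval_replaceLast (hi : 1 ≤ i) (hid : i ≤ d) (x : Fin n → A) (y : Fin n → ℕ → A)
    (ε : ℕ) (T : Tab (shape d i) n) :
    tabloidEval K (shape d i) (replaceLast i x y ε) (polytabloid K T) =
      (Matrix.of fun r s : Fin (i + 2) => replaceLast i x y ε (entry T r 0) s).det *
      (∏ c ∈ Finset.Ico 1 (d - i + 1),
        (y (entry T 0 c) 0 * y (entry T 1 c) 1 - y (entry T 0 c) 1 * y (entry T 1 c) 0)) *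
      ∏ c ∈ Finset.Ico (d - i + 1) d, y (entry T 0 c) 0 := by
  have h0 : ∀ a, replaceLast i x y ε a 0 = y a 0 := fun a => if_neg (by omega)
  have h1 : ∀ a, replaceLast i x y ε a 1 = y a 1 := fun a => if_neg (by omega)
  rw [tabloidEval_polytabloid_shape K hi hid]
  simp only [h0, h1]

/-- Columns of length at least 2 do not see the formal parameter, by a column operation; only the
columns of length 1 do. The replaced last row uses the unmodified row 0. -/
theorem tabloidEval_replaceLastAdd (hi : 1 ≤ i) (hid : i ≤ d) (x : Fin n → A)
    (y : Fin n → ℕ → A) (T : Tab (shape d i) n) :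
    tabloidEval K (shape d i) (replaceLastAdd i x y) (polytabloid K T) =
      Polynomial.C ((Matrix.of fun r s : Fin (i + 2) =>
        replaceLast i x y 0 (entry T r 0) s).det *
      ∏ c ∈ Finset.Ico 1 (d - i + 1),
        (y (entry T 0 c) 0 * y (entry T 1 c) 1 - y (entry T 0 c) 1 * y (entry T 1 c) 0)) *
      ∏ c ∈ Finset.Ico (d - i + 1) d,
        (Polynomial.C (y (entry T 0 c) 0) + Polynomial.X * Polynomial.C (y (entry T 0 c) 1)) := by
  have h0 : ∀ a, replaceLastAdd i x y a 0 =
      Polynomial.C (y a 0) + Polynomial.X * Polynomial.C (y a 1) := fun a => if_pos rfl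
  have h1 : ∀ a, replaceLastAdd i x y a 1 = Polynomial.C (y a 1) := fun a => by
    simp [replaceLastAdd, replaceLast, show i ≠ 0 by omega, eq_comm]
  rw [tabloidEval_polytabloid_shape K hi hid,
    det_of_add_mul_column (fun a r => Polynomial.C (replaceLast i x y 0 a r)) _ Polynomial.X
      (fun r : Fin (i + 2) => entry T r 0), Polynomial.C_mul, map_prod, RingHom.map_det]
  · refine congrArg₂ _ (congrArg₂ _ rfl ?_) ?_
    · refine Finset.prod_congr rfl fun c _ => ?_
      rw [h0, h0, h1, h1]
      simp only [map_sub, map_mul]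
      ring
    · exact Finset.prod_congr rfl fun c _ => h0 _
  · intro b
    simp [h0, replaceLast, show ¬ i = 0 by omega]
  · intro b r hr
    simp [replaceLastAdd, show r ≠ 0 by omega]

/-- Both sides are compared as sums over `j`: the two terms of the new 2×2 determinant match the two
evaluations in `diffEval`. -/
theorem diffEval_polytabloid {m : ℕ} (hi : 2 ≤ m + 2) (hid : m + 2 ≤ d) (x : Fin n → A)
    (y : Fin n → ℕ → A) (T : Tab (shape d (m + 2)) n) :
    diffEval K d (m + 2) x y (polytabloid K T) =
      ∑ j : Fin (m + 2 + 2), ∑ σ ∈ H T, (-1) ^ (j : ℕ) * (x (firstCol hi hid T j) *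
        tabloidEval K (shape d (m + 2 - 1)) y
          (polytabloid K (permTab σ (moveTab hi hid T j)))) := by
  set Q := ∏ c ∈ Finset.Ico 1 (d - (m + 2) + 1),
        (y (entry T 0 c) 0 * y (entry T 1 c) 1 - y (entry T 0 c) 1 * y (entry T 1 c) 0) with hQ
  set B := Finset.univ.image (tailEntry T) with hB
  set P := ∏ a ∈ B, y a 0 with hP
  set S := ∑ a ∈ B, y a 1 * ∏ a' ∈ B.erase a, y a' 0 with hS
  have hL : diffEval K d (m + 2) x y (polytabloid K T) =
      ((m + 1 : ℕ) : A) * ((-1) ^ (m + 2 + 1) * (Matrix.of fun r s : Fin (m + 2 + 2) =>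
        replaceLast (m + 2) x y 1 (entry T r 0) s).det) * Q * P -
      ((-1) ^ (m + 2 + 1) * (Matrix.of fun r s : Fin (m + 2 + 2) =>
        replaceLast (m + 2) x y 0 (entry T r 0) s).det) * Q * S := by
    rw [diffEval, LinearMap.smul_apply, LinearMap.sub_apply, LinearMap.smul_apply,
      LinearMap.comp_apply, tabloidEval_replaceLast K (by omega) hid,
      tabloidEval_replaceLastAdd K (by omega) hid, ← hQ,
      prod_tail_eq hid T fun a => y a 0,
      prod_tail_eq hid T fun a => Polynomial.C (y a 0) + Polynomial.X * Polynomial.C (y a 1),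
      ← hB, ← hP, LinearMap.restrictScalars_apply, Polynomial.lcoeff_apply,
      Polynomial.coeff_C_mul, coeff_one_prod_C_add_X_mul_C, ← hS, Algebra.smul_def,
      Algebra.smul_def]
    simp only [map_pow, map_neg, map_one, map_natCast]
    rw [show m + 2 - 1 = m + 1 from rfl]
    ring
  -- Each `σ` contributes the same full product, and `H` has `m + 1 = i - 1` elements.
  have hcard : ∑ σ ∈ H T, y (σ (tailEntry T 0)) 0 * ∏ k : Fin m, y (σ (tailEntry T k.succ)) 0 =
      ((m + 1 : ℕ) : A) * P := by
    rw [H_eq_tailPerms hid,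
      sum_tailPerms (tailEntry_injective hid T) (fun a => y a 0) (fun a => y a 0),
      Finset.sum_congr rfl fun a ha => Finset.mul_prod_erase _ (fun a => y a 0) ha,
      Finset.sum_const, Finset.card_image_of_injective _ (tailEntry_injective hid T)]
    simp [hP, hB]
  have hsum : ∑ σ ∈ H T, y (σ (tailEntry T 0)) 1 * ∏ k : Fin m, y (σ (tailEntry T k.succ)) 0 =
      S := by
    rw [H_eq_tailPerms hid,
      sum_tailPerms (tailEntry_injective hid T) (fun a => y a 1) (fun a => y a 0)]
  rw [hL, det_replaceLast, det_replaceLast, mul_comm ((m + 1 : ℕ) : A), mul_assoc _ Q, mul_assoc,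
    mul_assoc _ Q, Finset.sum_mul, Finset.sum_mul, ← Finset.sum_sub_distrib]
  refine Finset.sum_congr rfl fun j _ => ?_
  rw [Finset.sum_congr rfl fun σ hσ => by
    rw [tabloidEval_moveTab K hi hid y T j hσ, firstCol_eq_entry, ← hQ]]
  set Δ := (Matrix.of fun r s : Fin (m + 3) => y (entry T (j.succAbove r) 0) s).det with hΔ
  have hterm : ∀ σ ∈ H T, (-1) ^ (j : ℕ) * (x (entry T j 0) * (Δ * Q *
      (y (σ (tailEntry T 0)) 0 * y (entry T j 0) 1 - y (σ (tailEntry T 0)) 1 * y (entry T j 0) 0) *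
      ∏ k : Fin m, y (σ (tailEntry T k.succ)) 0)) =
      (-1) ^ (j : ℕ) * x (entry T j 0) * Δ * Q * y (entry T j 0) 1 *
        (y (σ (tailEntry T 0)) 0 * ∏ k : Fin m, y (σ (tailEntry T k.succ)) 0) -
      (-1) ^ (j : ℕ) * x (entry T j 0) * Δ * Q * y (entry T j 0) 0 *
        (y (σ (tailEntry T 0)) 1 * ∏ k : Fin m, y (σ (tailEntry T k.succ)) 0) := by
    intro σ _
    ring
  rw [Finset.sum_congr rfl hterm, Finset.sum_sub_distrib, ← Finset.mul_sum, ← Finset.mul_sum,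
    hcard, hsum]
  ring

end Move

/-! ### Maps out of the modules `F_i` -/

section Maps

variable {K : Type*} [Field K] {d i : ℕ}

theorem span_e (μ : YoungDiagram) (n : ℕ) :
    Submodule.span K (Set.range fun T : Tab μ n => e K T) = ⊤ := by
  refine Submodule.map_injective_of_injective (SpechtModule K μ n).injective_subtype ?_
  rw [Submodule.map_span, Submodule.map_top, Submodule.range_subtype, ← Set.range_comp]
  rfl

theorem linearMap_ext_of_span {M : Type*} [AddCommMonoid M] [Module (R K d) M]
    {S : Set (Tab (shape d i) (2 * d + 1))} (hS : Submodule.span K (e K '' S) = ⊤)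
    {D D' : F K d i →ₗ[R K d] M} (h : ∀ T ∈ S, D (gen K T) = D' (gen K T)) : D = D' := by
  -- Restricting scalars to `K` lets the tensor product be curried, so that a `K`-spanning set
  -- suffices.
  let _ : Module K M := Module.compHom M (algebraMap K (R K d))
  have : IsScalarTower K (R K d) M := IsScalarTower.of_algebraMap_smul fun _ _ => rfl
  refine TensorProduct.AlgebraTensorModule.curry_injective (LinearMap.ext_ring ?_)
  refine LinearMap.ext_on hS ?_
  rintro _ ⟨T, hT, rfl⟩
  exact h T hT

theorem linearMap_ext_of_gen {M : Type*} [AddCommMonoid M] [Module (R K d) M]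
    {D D' : F K d i →ₗ[R K d] M} (h : ∀ T, D (gen K T) = D' (gen K T)) : D = D' := by
  refine linearMap_ext_of_span (S := Set.univ) ?_ fun T _ => h T
  rw [Set.image_univ]
  exact span_e _ _

theorem map_degreePart_le {M : Type*} [AddCommGroup M] [Module K M] [Module (R K d) M]
    [IsScalarTower K (R K d) M] (D : F K d i →ₗ[R K d] M) (N : Submodule K M) (m : ℕ)
    (h : ∀ (k : ℕ) (p : R K d) (T : Tab (shape d i) (2 * d + 1)), p.IsHomogeneous k →
      k + (d + i + 1) = m → p • D (gen K T) ∈ N) :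
    ∀ z ∈ degreePart K d i m, D z ∈ N := by
  have hle : degreePart K d i m ≤ N.comap (D.restrictScalars K) := by
    refine Submodule.span_le.2 ?_
    rintro _ ⟨k, p, v, hp, hk, rfl⟩
    have hv : v ∈ Submodule.span K (Set.range fun T : Tab (shape d i) (2 * d + 1) => e K T) := by
      rw [span_e]; trivial
    change D (p ⊗ₜ[K] v) ∈ N
    induction hv using Submodule.span_induction with
    | mem x hx =>
      obtain ⟨T, rfl⟩ := hx
      have := h k p T hp hk
      rwa [← map_smul, gen, TensorProduct.smul_tmul', smul_eq_mul, mul_one] at this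
    | zero => simp
    | add x y _ _ hx hy => rw [TensorProduct.tmul_add, map_add]; exact N.add_mem hx hy
    | smul a x _ hx =>
      rw [TensorProduct.tmul_smul, LinearMap.map_smul_of_tower]
      exact N.smul_mem a hx
  exact hle

/-- The embedding of `F_i` into a polynomial ring over `R` with variables for the entries of the
rows of tabloids. -/
noncomputable def embed (K : Type*) [Field K] (d i : ℕ) :
    F K d i →ₗ[R K d] MvPolynomial (Fin (2 * d + 1) × ℕ) (R K d) :=
  (MvPolynomial.algebraTensorAlgEquiv K (R K d)).toLinearMap ∘ₗ
    (tabloidEval K (shape d i) (fun a r => MvPolynomial.X (a, r)) ∘ₗ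
      (SpechtModule K (shape d i) (2 * d + 1)).subtype).baseChange (R K d)

/-- The evaluation in independent variables is injective over `K`, and stays so after base change
because `R` is flat over `K`. -/
theorem embed_injective : Function.Injective (embed K d i) := by
  refine (MvPolynomial.algebraTensorAlgEquiv K (R K d)).injective.comp ?_
  exact Module.Flat.lTensor_preserves_injective_linearMap _
    ((tabloidEval_X_injective K).comp Subtype.val_injective)

theorem map_tabloidEval {A B : Type*} [CommRing A] [Algebra K A] [CommRing B] [Algebra K B]
    {μ : YoungDiagram} {n : ℕ} (f : A →ₐ[K] B) (y : Fin n → ℕ → A) (t : Tabloid μ n →₀ K) :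
    f (tabloidEval K μ y t) = tabloidEval K μ (fun a r => f (y a r)) t := by
  rw [← AlgHom.toLinearMap_apply, ← LinearMap.comp_apply]
  congr 1
  ext t
  simp [tabloidEval]

theorem embed_tmul (p : R K d) (v : SpechtModule K (shape d i) (2 * d + 1)) :
    embed K d i (p ⊗ₜ v) = MvPolynomial.C p *
      tabloidEval K (shape d i)
        (fun a r => (MvPolynomial.X (a, r) : MvPolynomial (Fin (2 * d + 1) × ℕ) (R K d))) v := by
  have h := map_tabloidEval (MvPolynomial.mapAlgHom (σ := Fin (2 * d + 1) × ℕ)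
    (Algebra.ofId K (R K d))) (fun a r => MvPolynomial.X (a, r)) v.1
  have hX : (fun (a : Fin (2 * d + 1)) (r : ℕ) =>
      MvPolynomial.mapAlgHom (σ := Fin (2 * d + 1) × ℕ) (Algebra.ofId K (R K d))
        (MvPolynomial.X (a, r))) = fun a r => MvPolynomial.X (a, r) := by
    funext a r
    exact MvPolynomial.map_X _ _
  rw [hX] at h
  rw [← h, ← MvPolynomial.smul_eq_C_mul]
  exact MvPolynomial.algebraTensorAlgEquiv_tmul ..

/-- Since `φ` lives on all tabloids, it respects every relation among polytabloids. It maps their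
span into the image of `embed`, where it can be pulled back by injectivity. -/
theorem exists_linearMap_of_embed {i' : ℕ}
    (φ : (Tabloid (shape d i) (2 * d + 1) →₀ K) →ₗ[K]
      MvPolynomial (Fin (2 * d + 1) × ℕ) (R K d))
    (δ : Tab (shape d i) (2 * d + 1) → F K d i')
    (h : ∀ T, φ (polytabloid K T) = embed K d i' (δ T)) :
    ∃ D : F K d i →ₗ[R K d] F K d i', ∀ T, D (gen K T) = δ T := by
  let ι : F K d i' →ₗ[K] MvPolynomial (Fin (2 * d + 1) × ℕ) (R K d) :=
    (embed K d i').restrictScalars K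
  have hι : Function.Injective ι := embed_injective
  have hrange : ∀ v : SpechtModule K (shape d i) (2 * d + 1), φ v ∈ LinearMap.range ι := by
    have hle : SpechtModule K (shape d i) (2 * d + 1) ≤ (LinearMap.range ι).comap φ := by
      refine Submodule.span_le.2 ?_
      rintro _ ⟨T, rfl⟩
      exact ⟨δ T, (h T).symm⟩
    exact fun v => hle v.2
  let ψ : SpechtModule K (shape d i) (2 * d + 1) →ₗ[K] F K d i' :=
    (LinearEquiv.ofInjective ι hι).symm.toLinearMap ∘ₗ
      (φ ∘ₗ (SpechtModule K (shape d i) (2 * d + 1)).subtype).codRestrict (LinearMap.range ι) hrange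
  refine ⟨ψ.liftBaseChange (R K d), fun T => hι ?_⟩
  rw [gen, LinearMap.liftBaseChange_tmul, one_smul]
  have : ι (ψ (e K T)) = φ (polytabloid K T) := by
    simp only [ψ, LinearMap.comp_apply, LinearEquiv.coe_coe]
    rw [← LinearEquiv.ofInjective_apply (h := hι), LinearEquiv.apply_symm_apply]
    rfl
  rw [this, h]
  rfl

theorem exists_differential (hi : 2 ≤ i) (hid : i ≤ d) :
    ∃ D : F K d i →ₗ[R K d] F K d (i - 1), ∀ T, D (gen K T) = diffValue K hi hid T := by
  obtain ⟨m, rfl⟩ : ∃ m, i = m + 2 := ⟨i - 2, by omega⟩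
  refine exists_linearMap_of_embed (diffEval K d (m + 2)
    (fun a => MvPolynomial.C (MvPolynomial.X a)) (fun a r => MvPolynomial.X (a, r))) _ fun T => ?_
  rw [diffEval_polytabloid K hi hid, diffValue, map_sum]
  refine Finset.sum_congr rfl fun j _ => ?_
  rw [map_sum]
  refine Finset.sum_congr rfl fun σ _ => ?_
  rw [LinearMap.map_smul_of_tower, embed_tmul, Algebra.smul_def]
  simp only [map_pow, map_neg, map_one]
  rfl

theorem differential_mem_degreePart (hi : 2 ≤ i) (hid : i ≤ d)
    {D : F K d i →ₗ[R K d] F K d (i - 1)} (hD : ∀ T, D (gen K T) = diffValue K hi hid T) (m : ℕ) :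
    ∀ z ∈ degreePart K d i m, D z ∈ degreePart K d (i - 1) m := by
  refine map_degreePart_le D _ m fun k p T hp hk => ?_
  rw [hD, diffValue, Finset.smul_sum]
  refine Submodule.sum_mem _ fun j _ => ?_
  rw [Finset.smul_sum]
  refine Submodule.sum_mem _ fun σ _ => ?_
  rw [smul_comm]
  -- The factor `x_{a_j}` raises the degree by one, which makes up for the shift dropping by one
  -- from `i` to `i - 1`.
  refine Submodule.smul_mem _ _ (Submodule.subset_span ⟨k + 1, _, _, ?_, ?_, rfl⟩)
  · exact hp.mul (MvPolynomial.isHomogeneous_X K _)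
  · omega

end Maps

/-! ### Specht polynomials -/

section Specht

theorem prod_eq_prod_entry {A : Type*} [CommMonoid A] {μ : YoungDiagram} {n : ℕ} [NeZero n]
    (T : Tab μ n) (d : ℕ) (len : ℕ → ℕ) (hlen : ∀ r c, (r, c) ∈ μ ↔ c < d ∧ r < len c)
    (g : Fin n → A) :
    ∏ a, g a = ∏ c ∈ Finset.range d, ∏ r ∈ Finset.range (len c), g (entry T r c) := by
  rw [← Finset.prod_fiberwise_of_maps_to (g := colOf T) (t := Finset.range d)
    fun a _ => Finset.mem_range.2 ((hlen _ _).1 (rowOf_colOf_mem T a)).1]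
  refine Finset.prod_congr rfl fun c hc => ?_
  rw [Finset.mem_range] at hc
  symm
  refine Finset.prod_bij (fun r _ => entry T r c) ?_ ?_ ?_ fun _ _ => rfl
  · intro r hr
    simpa using colOf_entry T ((hlen r c).2 ⟨hc, Finset.mem_range.1 hr⟩)
  · intro r hr r' hr' h
    exact (entry_inj T ((hlen r c).2 ⟨hc, Finset.mem_range.1 hr⟩)
      ((hlen r' c).2 ⟨hc, Finset.mem_range.1 hr'⟩) h).1
  · intro a ha
    have hac : colOf T a = c := by simpa using ha
    subst hac
    exact ⟨rowOf T a, Finset.mem_range.2 ((hlen _ _).1 (rowOf_colOf_mem T a)).2,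
      entry_rowOf_colOf T a⟩

theorem prod_below_eq_prod_entry {A : Type*} [CommMonoid A] {μ : YoungDiagram} {n : ℕ} [NeZero n]
    (T : Tab μ n) (d : ℕ) (len : ℕ → ℕ) (hlen : ∀ r c, (r, c) ∈ μ ↔ c < d ∧ r < len c)
    (g : Fin n → A) {r c : ℕ} (hrc : (r, c) ∈ μ) :
    ∏ b : Fin n with colOf T (entry T r c) = colOf T b ∧ rowOf T (entry T r c) < rowOf T b, g b =
      ∏ r' ∈ Finset.Ico (r + 1) (len c), g (entry T r' c) := by
  have hc := ((hlen r c).1 hrc).1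
  rw [rowOf_entry T hrc, colOf_entry T hrc]
  symm
  refine Finset.prod_bij (fun r _ => entry T r c) ?_ ?_ ?_ fun _ _ => rfl
  · intro r' hr
    rw [Finset.mem_Ico] at hr
    have h := (hlen r' c).2 ⟨hc, hr.2⟩
    simp only [Finset.mem_filter, Finset.mem_univ, true_and, rowOf_entry T h, colOf_entry T h]
    omega
  · intro r hr r' hr' h
    exact (entry_inj T ((hlen r c).2 ⟨hc, (Finset.mem_Ico.1 hr).2⟩)
      ((hlen r' c).2 ⟨hc, (Finset.mem_Ico.1 hr').2⟩) h).1
  · intro a ha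
    simp only [Finset.mem_filter, Finset.mem_univ, true_and] at ha
    obtain ⟨rfl, ha⟩ := ha
    exact ⟨rowOf T a, Finset.mem_Ico.2 ⟨ha, ((hlen _ _).1 (rowOf_colOf_mem T a)).2⟩,
      entry_rowOf_colOf T a⟩

theorem spechtPoly_shape_one (K : Type*) [Field K] {n d : ℕ} [NeZero n] (hd : 1 ≤ d)
    (T : Tab (shape d 1) n) :
    spechtPoly K T =
      ((MvPolynomial.X (entry T 0 0) - MvPolynomial.X (entry T 1 0)) *
        (MvPolynomial.X (entry T 0 0) - MvPolynomial.X (entry T 2 0)) *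
        (MvPolynomial.X (entry T 1 0) - MvPolynomial.X (entry T 2 0))) *
      ∏ c ∈ Finset.Ico 1 d,
        (MvPolynomial.X (entry T 0 c) - MvPolynomial.X (entry T 1 c)) := by
  have hlen : ∀ r c, (r, c) ∈ shape d 1 ↔ c < d ∧ r < if c = 0 then 3 else 2 := by
    intro r c
    rw [mem_shape]
    dsimp only
    split_ifs <;> omega
  rw [spechtPoly, prod_eq_prod_entry T d _ hlen, Finset.range_eq_Ico,
    Finset.prod_eq_prod_Ico_succ_bot (by omega)]
  have hcol : ∀ c < d, ∀ r < if c = 0 then 3 else 2,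
      ∏ b : Fin n with colOf T (entry T r c) = colOf T b ∧ rowOf T (entry T r c) < rowOf T b,
        (MvPolynomial.X (entry T r c) - MvPolynomial.X b : MvPolynomial (Fin n) K) =
      ∏ r' ∈ Finset.Ico (r + 1) (if c = 0 then 3 else 2),
        (MvPolynomial.X (entry T r c) - MvPolynomial.X (entry T r' c)) :=
    fun c hc r hr => prod_below_eq_prod_entry T d _ hlen _ ((hlen r c).2 ⟨hc, hr⟩)
  congr 1
  · rw [Finset.prod_congr rfl fun r hr => hcol 0 (by omega) r (Finset.mem_range.1 hr)]
    simp [Finset.prod_range_succ, Finset.prod_Ico_succ_top]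
  · refine Finset.prod_congr rfl fun c hc => ?_
    rw [Finset.mem_Ico] at hc
    rw [Finset.prod_congr rfl fun r hr => hcol c (by omega) r (Finset.mem_range.1 hr)]
    simp [Finset.prod_range_succ, show c ≠ 0 by omega]

/-- Each column gives a Vandermonde determinant. The columns of length 3 and 2 each differ by a sign
from their factor of the Specht polynomial, hence `(-1) ^ d` over `d` columns. -/
theorem tabloidEval_X_pow (K : Type*) [Field K] {n d : ℕ} [NeZero n] (hd : 1 ≤ d)
    (T : Tab (shape d 1) n) :
    tabloidEval K (shape d 1) (fun a r => (MvPolynomial.X a ^ r : MvPolynomial (Fin n) K))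
      (polytabloid K T) = (-1) ^ d * spechtPoly K T := by
  rw [tabloidEval_polytabloid_shape K le_rfl hd, spechtPoly_shape_one K hd,
    show d - 1 + 1 = d by omega, Finset.Ico_self, Finset.prod_empty, mul_one]
  have hneg : ∏ c ∈ Finset.Ico 1 d,
      ((MvPolynomial.X (entry T 0 c) ^ 0 * MvPolynomial.X (entry T 1 c) ^ 1 -
        MvPolynomial.X (entry T 0 c) ^ 1 * MvPolynomial.X (entry T 1 c) ^ 0 :
          MvPolynomial (Fin n) K)) = (-1) ^ (d - 1) * ∏ c ∈ Finset.Ico 1 d,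
        (MvPolynomial.X (entry T 0 c) - MvPolynomial.X (entry T 1 c)) := by
    have h := Finset.prod_const (s := Finset.Ico 1 d) (-1 : MvPolynomial (Fin n) K)
    rw [Nat.card_Ico] at h
    rw [← h, ← Finset.prod_mul_distrib]
    refine Finset.prod_congr rfl fun c _ => ?_
    ring
  have hdet : (Matrix.of fun r s : Fin (1 + 2) =>
      (MvPolynomial.X (entry T r 0) ^ (s : ℕ) : MvPolynomial (Fin n) K)).det =
      -((MvPolynomial.X (entry T 0 0) - MvPolynomial.X (entry T 1 0)) *
        (MvPolynomial.X (entry T 0 0) - MvPolynomial.X (entry T 2 0)) *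
        (MvPolynomial.X (entry T 1 0) - MvPolynomial.X (entry T 2 0))) := by
    change (Matrix.of fun r s : Fin 3 =>
      (MvPolynomial.X (entry T r 0) ^ (s : ℕ) : MvPolynomial (Fin n) K)).det = _
    rw [Matrix.det_fin_three]
    simp
    ring
  have hpow : ((-1) ^ d : MvPolynomial (Fin n) K) = -1 * (-1) ^ (d - 1) := by
    rw [← pow_succ', show d - 1 + 1 = d by omega]
  rw [hneg, hdet, hpow]
  ring

theorem spechtPoly_isHomogeneous (K : Type*) [Field K] {n d : ℕ} [NeZero n] (hd : 1 ≤ d)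
    (T : Tab (shape d 1) n) : (spechtPoly K T).IsHomogeneous (d + 2) := by
  have hsub : ∀ a b : Fin n,
      (MvPolynomial.X a - MvPolynomial.X b : MvPolynomial (Fin n) K).IsHomogeneous 1 :=
    fun a b => (MvPolynomial.isHomogeneous_X K a).sub (MvPolynomial.isHomogeneous_X K b)
  have hprod := MvPolynomial.IsHomogeneous.prod (Finset.Ico 1 d)
    (fun c => (MvPolynomial.X (entry T 0 c) - MvPolynomial.X (entry T 1 c) :
      MvPolynomial (Fin n) K)) (fun _ => 1) fun c _ => hsub _ _
  have h := (((hsub (entry T 0 0) (entry T 1 0)).mul (hsub (entry T 0 0) (entry T 2 0))).mul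
    (hsub (entry T 1 0) (entry T 2 0))).mul hprod
  rw [spechtPoly_shape_one K hd]
  convert h using 1
  simp
  omega

theorem exists_differential_one (K : Type*) [Field K] {d : ℕ} (hd : 1 ≤ d) :
    ∃ D : F K d 1 →ₗ[R K d] R K d, ∀ T, D (gen K T) = spechtPoly K T := by
  refine ⟨(((-1 : K) ^ d • tabloidEval K (shape d 1) fun a r => (MvPolynomial.X a ^ r : R K d)) ∘ₗ
    (SpechtModule K (shape d 1) (2 * d + 1)).subtype).liftBaseChange (R K d), fun T => ?_⟩
  rw [gen, LinearMap.liftBaseChange_tmul, one_smul]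
  change (-1 : K) ^ d • tabloidEval K (shape d 1) (fun a r => (MvPolynomial.X a ^ r : R K d))
    (polytabloid K T) = _
  rw [tabloidEval_X_pow K hd, Algebra.smul_def, ← mul_assoc]
  simp [← mul_pow]

end Specht

/-! ### Standard polytabloids of hook shape -/

section Hook

variable {n d : ℕ} [NeZero n]

theorem tabloidEval_polytabloid_hook (K : Type*) [Field K] {A : Type*} [CommRing A] [Algebra K A]
    (hd : 1 ≤ d) (y : Fin n → ℕ → A) (T : Tab (shape d d) n) :
    tabloidEval K (shape d d) y (polytabloid K T) =
      (Matrix.of fun r s : Fin (d + 2) => y (entry T r 0) s).det *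
        ∏ k : Fin (d - 1), y (entry T 0 (k + 1)) 0 := by
  rw [tabloidEval_polytabloid_shape K hd le_rfl, Nat.sub_self, zero_add, Finset.Ico_self,
    Finset.prod_empty, mul_one, Finset.prod_Ico_eq_prod_range, Finset.prod_range]
  simp only [add_comm 1]

theorem column_mem_hook (r : Fin (d + 2)) (hd : 1 ≤ d) : ((r : ℕ), 0) ∈ shape d d := by
  have := r.2
  rw [mem_shape]
  dsimp only
  omega

theorem row_mem_hook (k : Fin (d - 1)) : (0, (k : ℕ) + 1) ∈ shape d d := by
  have := k.2
  rw [mem_shape]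
  dsimp only
  omega

/-- Sorting the first column and, separately, the rest of the first row changes the polytabloid only
by a sign. The result is standard because the smallest number reaches the corner. -/
theorem exists_standard_of_colOf_zero (K : Type*) [Field K] (hd : 1 ≤ d) (T : Tab (shape d d) n)
    (h0 : colOf T 0 = 0) :
    ∃ T' : Tab (shape d d) n, IsStandard T' ∧ ∃ ε : K, e K T = ε • e K T' := by
  let a : Fin (d + 2) → Fin n := fun r => entry T r 0
  let b : Fin (d - 1) → Fin n := fun k => entry T 0 (k + 1)
  have ha : Function.Injective a := fun r r' h =>
    Fin.ext (entry_inj T (column_mem_hook r hd) (column_mem_hook r' hd) h).1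
  have hb : Function.Injective b := fun k k' h =>
    Fin.ext (Nat.succ_injective (entry_inj T (row_mem_hook k) (row_mem_hook k') h).2)
  have hab : ∀ r k, a r ≠ b k := fun r k h =>
    absurd (entry_inj T (column_mem_hook r hd) (row_mem_hook k) h).2 (by omega)
  let τ := Tuple.sort a
  let ρ := Tuple.sort b
  let π := τ.viaFintypeEmbedding ⟨a, ha⟩ * ρ.viaFintypeEmbedding ⟨b, hb⟩
  have hπa : ∀ r, π (a r) = a (τ r) := by
    intro r
    have h1 : ρ.viaFintypeEmbedding ⟨b, hb⟩ (a r) = a r := by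
      refine Equiv.Perm.viaFintypeEmbedding_apply_notMem_range _ _ ?_
      rintro ⟨k, hk⟩
      exact hab r k hk.symm
    rw [Equiv.Perm.mul_apply, h1]
    exact Equiv.Perm.viaFintypeEmbedding_apply_image τ ⟨a, ha⟩ r
  have hπb : ∀ k, π (b k) = b (ρ k) := by
    intro k
    have h1 : ρ.viaFintypeEmbedding ⟨b, hb⟩ (b k) = b (ρ k) :=
      Equiv.Perm.viaFintypeEmbedding_apply_image ρ ⟨b, hb⟩ k
    rw [Equiv.Perm.mul_apply, h1]
    refine Equiv.Perm.viaFintypeEmbedding_apply_notMem_range _ _ ?_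
    rintro ⟨r, hr⟩
    exact hab r _ hr
  have hcol : ∀ r : Fin (d + 2), entry (permTab π T) r 0 = a (τ r) := fun r => by
    rw [entry_permTab _ _ (column_mem_hook r hd)]
    exact hπa r
  have hrow : ∀ k : Fin (d - 1), entry (permTab π T) 0 (k + 1) = b (ρ k) := fun k => by
    rw [entry_permTab _ _ (row_mem_hook k)]
    exact hπb k
  have haτ : StrictMono (a ∘ τ) :=
    (Tuple.monotone_sort a).strictMono_of_injective (ha.comp τ.injective)
  have hbρ : StrictMono (b ∘ ρ) :=
    (Tuple.monotone_sort b).strictMono_of_injective (hb.comp ρ.injective)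
  have hcorner : a (τ 0) = 0 := by
    have hm := mem_shape.1 (rowOf_colOf_mem T 0)
    have he := entry_rowOf_colOf T 0
    rw [h0] at hm he
    obtain ⟨r, hr⟩ := τ.surjective ⟨rowOf T 0, hm.1.1⟩
    have har : a (τ r) = 0 := by rw [hr]; exact he
    exact le_antisymm (har ▸ haτ.monotone (Fin.zero_le r)) (Fin.zero_le _)
  -- Only the column permutation `τ` produces a sign; `ρ` permutes commuting factors.
  refine ⟨permTab π T, ⟨?_, ?_⟩, ((Equiv.Perm.sign τ : ℤ) : K), ?_⟩
  · rintro ⟨⟨r, c⟩, hp⟩ ⟨⟨r', c'⟩, hq⟩ hr hc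
    dsimp only at hr hc
    subst hr
    rw [← entry_of_mem, ← entry_of_mem]
    have hp' := mem_shape.1 hp
    have hq' := mem_shape.1 hq
    dsimp only at hp' hq'
    obtain rfl : r = 0 := by omega
    obtain ⟨k', rfl⟩ : ∃ k' : Fin (d - 1), c' = k' + 1 := ⟨⟨c' - 1, by omega⟩, by
      dsimp only; omega⟩
    rw [hrow]
    by_cases hc0 : c = 0
    · subst hc0
      have := hcol 0
      rw [Fin.val_zero] at this
      rw [this, hcorner]
      exact lt_of_le_of_ne (Fin.zero_le _) fun h => hab _ _ (hcorner.trans h)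
    · obtain ⟨k, rfl⟩ : ∃ k : Fin (d - 1), c = k + 1 := ⟨⟨c - 1, by omega⟩, by
        dsimp only; omega⟩
      rw [hrow]
      exact hbρ (Fin.lt_def.2 (by omega))
  · rintro ⟨⟨r, c⟩, hp⟩ ⟨⟨r', c'⟩, hq⟩ hc hr
    dsimp only at hr hc
    subst hc
    rw [← entry_of_mem, ← entry_of_mem]
    have hp' := mem_shape.1 hp
    have hq' := mem_shape.1 hq
    dsimp only at hp' hq'
    obtain rfl : c = 0 := by omega
    have h1 := hcol ⟨r, hp'.1.1⟩
    have h2 := hcol ⟨r', hq'.1.1⟩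
    dsimp only at h1 h2
    rw [h1, h2]
    exact haτ (Fin.lt_def.2 hr)
  · refine Subtype.ext (tabloidEval_X_injective K ?_)
    change tabloidEval K _ _ (polytabloid K T) =
      tabloidEval K _ _ (_ • polytabloid K (permTab π T))
    rw [map_smul, tabloidEval_polytabloid_hook K hd, tabloidEval_polytabloid_hook K hd]
    simp only [hcol, hrow]
    have hdet := Matrix.det_permute τ (Matrix.of fun r s : Fin (d + 2) =>
      (MvPolynomial.X (a r, (s : ℕ)) : MvPolynomial (Fin n × ℕ) K))
    have hprod := Equiv.prod_comp ρ fun k =>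
      (MvPolynomial.X (b k, 0) : MvPolynomial (Fin n × ℕ) K)
    rw [hprod]
    change _ = _ • (((Matrix.of fun r s : Fin (d + 2) =>
      (MvPolynomial.X (a r, (s : ℕ)) : MvPolynomial (Fin n × ℕ) K)).submatrix τ id).det * _)
    rw [hdet, Algebra.smul_def, map_intCast, ← mul_assoc, ← mul_assoc, ← Int.cast_mul]
    have hsign : ((Equiv.Perm.sign τ : ℤ) * (Equiv.Perm.sign τ : ℤ) : ℤ) = 1 := by
      rw [← Units.val_mul, Int.units_mul_self, Units.val_one]
    rw [hsign, Int.cast_one, one_mul]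

/-- A Garnir-type relation, obtained from Cramer's rule for the first-column matrix with the entry
`z` as right-hand side. -/
theorem e_eq_sum_swap (K : Type*) [Field K] (hd : 1 ≤ d) (T : Tab (shape d d) n)
    (k : Fin (d - 1)) :
    e K T = ∑ j : Fin (d + 2),
      e K (permTab (Equiv.swap (entry T 0 (k + 1)) (entry T j 0)) T) := by
  set z := entry T 0 (k + 1) with hz
  refine Subtype.ext (tabloidEval_X_injective K ?_)
  rw [Submodule.coe_sum, map_sum]
  change tabloidEval K _ _ (polytabloid K T) = ∑ j : Fin (d + 2),
    tabloidEval K _ _ (polytabloid K (permTab (Equiv.swap z (entry T j 0)) T))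
  set y : Fin n → ℕ → MvPolynomial (Fin n × ℕ) K := fun a r => MvPolynomial.X (a, r)
  let M : Matrix (Fin (d + 2)) (Fin (d + 2)) (MvPolynomial (Fin n × ℕ) K) :=
    Matrix.of fun s r => y (entry T r 0) s
  -- Coordinate `0` is the first row of the tabloid, where `z` stands in `T` and `entry T j 0`
  -- stands after the swap.
  have hcramer := congrFun (M.mulVec_cramer fun s => y z s) 0
  simp only [Matrix.mulVec, dotProduct, Matrix.cramer_apply, Pi.smul_apply, smul_eq_mul] at hcramer
  have hM : (Matrix.of fun r s : Fin (d + 2) => y (entry T r 0) s).det = M.det :=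
    (Matrix.det_transpose M)
  rw [tabloidEval_polytabloid_hook K hd, hM,
    ← Finset.mul_prod_erase _ _ (Finset.mem_univ k), ← mul_assoc]
  have hcramer' : M.det * y (entry T 0 (k + 1)) 0 = _ := hcramer.symm
  rw [hcramer', Finset.sum_mul]
  refine Finset.sum_congr rfl fun j _ => ?_
  have hne : ∀ r : Fin (d + 2), entry T r 0 ≠ z := fun r h =>
    absurd (entry_inj T (column_mem_hook r hd) (row_mem_hook k) h).2 (by omega)
  rw [tabloidEval_polytabloid_hook K hd, ← Finset.mul_prod_erase _ _ (Finset.mem_univ k),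
    mul_comm (M 0 j), mul_assoc]
  refine congrArg₂ _ ?_ (congrArg₂ _ ?_ ?_)
  · rw [← Matrix.det_transpose]
    congr 1
    ext1 r s
    rw [Matrix.transpose_apply, Matrix.updateCol_apply, Matrix.of_apply,
      entry_permTab _ _ (column_mem_hook r hd)]
    split_ifs with h
    · rw [h, Equiv.swap_apply_right]
    · rw [Equiv.swap_apply_of_ne_of_ne (hne r) fun h' => h (Fin.ext
        (entry_inj T (column_mem_hook r hd) (column_mem_hook j hd) h').1)]
      rfl
  · rw [entry_permTab _ _ (row_mem_hook k), ← hz, Equiv.swap_apply_left]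
    rfl
  · refine Finset.prod_congr rfl fun l hl => ?_
    rw [entry_permTab _ _ (row_mem_hook l), Equiv.swap_apply_of_ne_of_ne]
    · exact fun h => Finset.ne_of_mem_erase hl (Fin.ext (Nat.succ_injective
        (entry_inj T (row_mem_hook l) (row_mem_hook k) h).2))
    · exact fun h => absurd (entry_inj T (row_mem_hook l) (column_mem_hook j hd) h).2 (by omega)

theorem span_standard_hook (K : Type*) [Field K] (hd : 1 ≤ d) :
    Submodule.span K (e K '' {T : Tab (shape d d) n | IsStandard T}) = ⊤ := by
  have hzero : ∀ T : Tab (shape d d) n, colOf T 0 = 0 →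
      e K T ∈ Submodule.span K (e K '' {T : Tab (shape d d) n | IsStandard T}) := by
    intro T hT
    obtain ⟨T', hT', ε, h⟩ := exists_standard_of_colOf_zero K hd T hT
    rw [h]
    exact Submodule.smul_mem _ _ (Submodule.subset_span ⟨T', hT', rfl⟩)
  rw [eq_top_iff, ← span_e, Submodule.span_le]
  rintro _ ⟨T, rfl⟩
  -- If the smallest number is not in the first column, then each swap in `e_eq_sum_swap` brings it
  -- there.
  by_cases hT : colOf T 0 = 0
  · exact hzero T hT
  · have hm := mem_shape.1 (rowOf_colOf_mem T 0)
    have he := entry_rowOf_colOf T 0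
    dsimp only at hm
    rw [show rowOf T 0 = 0 by omega] at he
    obtain ⟨k, hk⟩ : ∃ k : Fin (d - 1), colOf T 0 = k + 1 :=
      ⟨⟨colOf T 0 - 1, by omega⟩, by dsimp only; omega⟩
    rw [hk] at he
    change e K T ∈ _
    rw [e_eq_sum_swap K hd T k]
    refine Submodule.sum_mem _ fun j _ => hzero _ ?_
    rw [he]
    have h : entry (permTab (Equiv.swap 0 (entry T j 0)) T) j 0 = 0 := by
      rw [entry_permTab _ _ (column_mem_hook j hd), Equiv.swap_apply_right]
    have h' := colOf_entry (permTab (Equiv.swap 0 (entry T j 0)) T) (column_mem_hook j hd)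
    rwa [h] at h'

end Hook

end SpechtComplex

/-! ### Existence, homogeneity and uniqueness of the maps -/

theorem theorem6p2 (K : Type*) [Field K] (d : ℕ) (hd : 1 ≤ d) :
    (∃ D : SpechtComplex.F K d 1 →ₗ[SpechtComplex.R K d] SpechtComplex.R K d,
      (∀ T : SpechtComplex.Tab (SpechtComplex.shape d 1) (2 * d + 1),
        D (SpechtComplex.gen K T) = SpechtComplex.spechtPoly K T) ∧
      (∀ m, ∀ z ∈ SpechtComplex.degreePart K d 1 m, (D z).IsHomogeneous m) ∧
      (∀ D' : SpechtComplex.F K d 1 →ₗ[SpechtComplex.R K d] SpechtComplex.R K d,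
        (∀ T : SpechtComplex.Tab (SpechtComplex.shape d 1) (2 * d + 1),
          D' (SpechtComplex.gen K T) = SpechtComplex.spechtPoly K T) → D' = D)) ∧
    (∀ (i : ℕ) (hi : 2 ≤ i) (hid : i < d),
      ∃ D : SpechtComplex.F K d i →ₗ[SpechtComplex.R K d] SpechtComplex.F K d (i - 1),
        (∀ T : SpechtComplex.Tab (SpechtComplex.shape d i) (2 * d + 1),
          D (SpechtComplex.gen K T) = SpechtComplex.diffValue K hi hid.le T) ∧
        (∀ m, ∀ z ∈ SpechtComplex.degreePart K d i m,
          D z ∈ SpechtComplex.degreePart K d (i - 1) m) ∧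
        (∀ D' : SpechtComplex.F K d i →ₗ[SpechtComplex.R K d] SpechtComplex.F K d (i - 1),
          (∀ T : SpechtComplex.Tab (SpechtComplex.shape d i) (2 * d + 1),
            D' (SpechtComplex.gen K T) = SpechtComplex.diffValue K hi hid.le T) → D' = D)) ∧
    (∀ hd2 : 2 ≤ d,
      ∃ D : SpechtComplex.F K d d →ₗ[SpechtComplex.R K d] SpechtComplex.F K d (d - 1),
        (∀ T : SpechtComplex.Tab (SpechtComplex.shape d d) (2 * d + 1),
          SpechtComplex.IsStandard T →
            D (SpechtComplex.gen K T) = SpechtComplex.diffValue K hd2 le_rfl T) ∧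
        (∀ m, ∀ z ∈ SpechtComplex.degreePart K d d m,
          D z ∈ SpechtComplex.degreePart K d (d - 1) m) ∧
        (∀ D' : SpechtComplex.F K d d →ₗ[SpechtComplex.R K d] SpechtComplex.F K d (d - 1),
          (∀ T : SpechtComplex.Tab (SpechtComplex.shape d d) (2 * d + 1),
            SpechtComplex.IsStandard T →
              D' (SpechtComplex.gen K T) = SpechtComplex.diffValue K hd2 le_rfl T) → D' = D)) := by
  refine ⟨?_, fun i hi hid => ?_, fun hd2 => ?_⟩
  · obtain ⟨D, hD⟩ := SpechtComplex.exists_differential_one K hd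
    refine ⟨D, hD, fun m z hz => ?_, fun D' hD' =>
      SpechtComplex.linearMap_ext_of_gen fun T => (hD' T).trans (hD T).symm⟩
    refine (MvPolynomial.mem_homogeneousSubmodule _ _).1 (SpechtComplex.map_degreePart_le D
      (MvPolynomial.homogeneousSubmodule _ K m) m (fun k p T hp hk => ?_) z hz)
    rw [hD, MvPolynomial.mem_homogeneousSubmodule, ← hk]
    exact hp.mul (SpechtComplex.spechtPoly_isHomogeneous K hd T)
  · obtain ⟨D, hD⟩ := SpechtComplex.exists_differential (K := K) hi hid.le
    exact ⟨D, hD, SpechtComplex.differential_mem_degreePart hi hid.le hD, fun D' hD' =>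
      SpechtComplex.linearMap_ext_of_gen fun T => (hD' T).trans (hD T).symm⟩
  · obtain ⟨D, hD⟩ := SpechtComplex.exists_differential (K := K) hd2 le_rfl
    -- The formula for `D` holds for every tableau even when `i = d`; standardness matters only for
    -- uniqueness.
    exact ⟨D, fun T _ => hD T, SpechtComplex.differential_mem_degreePart hd2 le_rfl hD,
      fun D' hD' => SpechtComplex.linearMap_ext_of_span (SpechtComplex.span_standard_hook K hd)
        fun T hT => (hD' T hT).trans (hD T).symm⟩
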